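/- Let $k$ be a perfect field, let $V^{(d-1)}$ be a smooth $k$-scheme, let $\beta\colon V^{(d)}\to V^{(d-1)}$ be a smooth morphism of relative dimension one, and let $z$ be a global section of $\mathcal O_{V^{(d)}}$ such that the closed subscheme $\{z=0\}$ is a section of $\beta$ (it maps isomorphically to $V^{(d-1)}$). Let $f_n(z)=z^n+a_1z^{n-1}+\dots+a_n$ be a monic polynomial of degree $n$ with coefficients $a_j$ global sections of $\mathcal O_{V^{(d-1)}}$, and let $X\subset V^{(d)}$ be the hypersurface $f_n(z)=0$. Assume that $z$ is a relative coordinate along $X$, i.e. the morphism $(\beta,z)\colon V^{(d)}\to\mathbb A^1_{V^{(d-1)}}$ is étale on a neighbourhood of $X$ (this holds in particular when $X=\operatorname{Spec}\mathcal O_{V^{(d-1)}}[z]/(f_n(z))$). For a point $x$ of a scheme, let $\nu_x$ denote the order with respect to powers of the maximal ideal of the local ring at $x$, $\nu_x(a)=\sup\{m: a\in\mathfrak m_x^m\}\in\mathbb N\cup\{\infty\}$. Let $f_nW^n$ denote the Rees algebra $\mathcal O_{V^{(d)}}[f_n(z)W^n]=\bigoplus_m I_mW^m$, and let $$\operatorname{Sing}(f_nW^n)=\{x\in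 V^{(d)} : \nu_x(I_m)\ge m \text{ for all } m\},$$ that is, for $n\ge 1$, the set of points at which $f_n(z)$ has order at least $n$. Fix a point $y\in V^{(d-1)}$. The slope of $f_n(z)W^n$ at $y$ is $$q=Sl(f_n(z)W^n)(y)=\min_{1\le j\le n}\frac{\nu_y(a_j)}{j}\in\mathbb Q\cup\{\infty\}.$$ Let $gr(\mathcal O_{V^{(d-1)},y})=\bigoplus_m \mathfrak m_y^m/\mathfrak m_y^{m+1}$. The weighted initial form of $f_n(z)$ at $y$ is $$\sum_{0\le j\le n}A_j^{jq}Z^{n-j}\in gr(\mathcal O_{V^{(d-1)},y})[Z],$$ where $a_0=1$, $A_0^0=1$, and for $j\ge1$, $A_j^{jq}$ is the class of $a_j$ in $\mathfrak m_y^{jq}/\mathfrak m_y^{jq+1}$ if $jq$ is an integer and $A_j^{jq}=0$ otherwise (so the form is $Z^n$ if $q=\infty$). One says that $f_n(z)$ is in normal form at $y$ if its weighted initial form at $y$ is not an $n$-th power in $gr(\mathcal O_{V^{(d-1)},y})[Z]$. Proposition. If $f_n(z)$ is in normal form at $y$, then $y\in\beta(\operatorname{Sing}(f_nW^n))$ if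 and only if $Sl(f_n(z)W^n)(y)\ge 1$. -/

import Mathlib

open AlgebraicGeometry CategoryTheory Polynomial

universe u

noncomputable section

namespace HypersurfaceSlope

section LocalRing

variable {R : Type u} [CommRing R] [IsLocalRing R]

/-- The order `ν(a)` of an element of a local ring `(R, 𝔪)`: the supremum in `ℕ ∪ {∞}` of all `m`
with `a ∈ 𝔪 ^ m`. -/
def order (a : R) : ℕ∞ :=
  ⨆ (m : ℕ) (_ : a ∈ IsLocalRing.maximalIdeal R ^ m), (m : ℕ∞)

/-- The slope `min_{1 ≤ j ≤ n} ν(a_j) / j`, with values in `ℚ ∪ {∞}`, of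
`Z ^ n + a_1 Z ^ (n - 1) + ⋯ + a_n`, so that `a_j` is the coefficient of `Z ^ (n - j)`. -/
def polySlope (n : ℕ) (f : R[X]) : WithTop ℚ :=
  (Finset.Icc 1 n).inf fun j => ENat.map (fun m : ℕ => (m : ℚ) / (j : ℚ)) (order (f.coeff (n - j)))

variable (R) in
/-- The associated graded ring `gr(R) = ⨁ 𝔪 ^ m / 𝔪 ^ (m + 1)` of a local ring, presented as
the quotient of the Rees algebra `⨁ 𝔪 ^ m t ^ m ⊆ R[t]` by the ideal `𝔪 · ⨁ 𝔪 ^ m t ^ m`. -/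
abbrev Gr : Type u :=
  reesAlgebra (IsLocalRing.maximalIdeal R) ⧸
    (IsLocalRing.maximalIdeal R).map
      (algebraMap R (reesAlgebra (IsLocalRing.maximalIdeal R)))

/-- The class of `a ∈ 𝔪 ^ m` in `𝔪 ^ m / 𝔪 ^ (m + 1) ⊆ gr(R)`. -/
def grClass (m : ℕ) (a : R) (ha : a ∈ IsLocalRing.maximalIdeal R ^ m) : Gr R :=
  Ideal.Quotient.mk _ ⟨monomial m a, reesAlgebra.monomial_mem.mpr ha⟩

open Classical in
/-- The degree `jq` part of `a` in `gr(R)`: it is the class of `a` in `𝔪 ^ m / 𝔪 ^ (m + 1)` if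
`m = jq` is a natural number (and `a ∈ 𝔪 ^ m`), and it is `0` if `jq` is not a natural number.
Here `0 • ∞ = 0` and `j • ∞ = ∞` for `j ≥ 1`. -/
def gradedPart (q : WithTop ℚ) (j : ℕ) (a : R) : Gr R :=
  if h : ∃ m : ℕ, ((m : ℚ) : WithTop ℚ) = j • q ∧ a ∈ IsLocalRing.maximalIdeal R ^ m then
    grClass h.choose a h.choose_spec.2
  else 0

/-- The weighted initial form `∑_{0 ≤ j ≤ n} A_j Z ^ (n - j) ∈ gr(R)[Z]` of
`Z ^ n + a_1 Z ^ (n - 1) + ⋯ + a_n`, where `q` is the slope and `A_j` is the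
degree `jq` part of `a_j`. -/
def weightedInitialForm (n : ℕ) (f : R[X]) : (Gr R)[X] :=
  ∑ j ∈ Finset.range (n + 1), monomial (n - j) (gradedPart (polySlope n f) j (f.coeff (n - j)))

/-- Normal form: the weighted initial form is not an `n`-th power in `gr(R)[Z]`. -/
def IsNormalForm (n : ℕ) (f : R[X]) : Prop :=
  ¬ ∃ g : (Gr R)[X], weightedInitialForm n f = g ^ n

end LocalRing

section Schemes

variable {V S : Scheme.{u}}

/-- The germ at a point of a polynomial with coefficients in the ring of global functions. -/
def germPoly (f : Γ(S, ⊤)[X]) (y : S) : (S.presheaf.stalk y)[X] :=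
  f.map (S.presheaf.germ ⊤ y trivial).hom

/-- The stalk at `x` of the Rees algebra `𝒪_V[h W ^ n] ⊆ 𝒪_V[W]` generated by a global function
`h` placed in degree `n`. Its degree `m` part consists of the `a W ^ m` with `a ∈ (I_m)_x`. -/
def reesStalk (h : Γ(V, ⊤)) (n : ℕ) (x : V) :
    Subalgebra (V.presheaf.stalk x) (V.presheaf.stalk x)[X] :=
  Algebra.adjoin (V.presheaf.stalk x) {monomial n ((V.presheaf.germ ⊤ x trivial).hom h)}

/-- The singular locus of the Rees algebra `𝒪_V[h W ^ n] = ⨁ I_m W ^ m`: the set of all points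
`x` with `ν_x(I_m) ≥ m` for all `m`. -/
def singLocus (h : Γ(V, ⊤)) (n : ℕ) : Set V :=
  {x | ∀ (m : ℕ) (a : V.presheaf.stalk x), monomial m a ∈ reesStalk h n x → (m : ℕ∞) ≤ order a}

/-- The global function `f(z)` on `V`, for `f` with coefficients in the global functions on `S`. -/
def evalAt (β : V ⟶ S) (z : Γ(V, ⊤)) (f : Γ(S, ⊤)[X]) : Γ(V, ⊤) :=
  f.eval₂ β.appTop.hom z

/-- `{z = 0}` is a section of `β`: the closed subscheme `z = 0` of `V` maps isomorphically
to `S`. -/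
def IsZeroSection (β : V ⟶ S) (z : Γ(V, ⊤)) : Prop :=
  IsIso ((Scheme.IdealSheafData.ofIdealTop (Ideal.span {z})).subschemeι ≫ β)

/-- `z` is a relative coordinate for `β` along the hypersurface `h = 0`: the morphism
`(β, z) : V ⟶ 𝔸¹_S` is étale on an open neighbourhood of that hypersurface. -/
def IsCoordinateAlong (β : V ⟶ S) (z h : Γ(V, ⊤)) : Prop :=
  ∃ U : V.Opens, V.zeroLocus {h} ⊆ (U : Set V) ∧
    Etale (U.ι ≫ AffineSpace.homOfVector (n := PUnit.{u + 1}) β (fun _ => z))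

end Schemes

end HypersurfaceSlope

end

/-!
Write `R` for the local ring of `S` at `y`, `𝔪` for its maximal ideal and `κ` for its residue field.
A point `x` lies in the singular locus if and only if the germ of `f(z)` at `x` lies in `𝔪_x ^ n`
(`mem_singLocus_iff`), and the slope is at least `1` if and only if `a_j ∈ 𝔪 ^ j` for all `j`
(`one_le_polySlope_iff`).

If the slope is at least `1`, let `x` be the point over `y` on the section `z = 0`. Every term
`a_j z ^ (n - j)` lies in `𝔪_x ^ n`, so `x` is singular (`exists_mem_of_one_le_polySlope`).

Conversely, let `x` be a singular point over `y`. Then `x` lies on the hypersurface, so `(β, z)` is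
étale at `x`. On stalks an étale morphism is faithfully flat and carries the maximal ideal to
generators of the maximal ideal, so `f` still has order at least `n` at the image of `x` in the
affine line, that is, in the local ring `R[Z]_P` for a prime `P` over `𝔪`
(`mem_maximalIdeal_pow_of_stalkMap_mem`, `exists_prime_of_etale`). Modulo `𝔪`, the monic polynomial
`f` of degree `n` is divisible by the `n`-th power of a generator of the image of `P` in `κ[Z]`, so
this generator is linear and `f ≡ (Z - c) ^ n` (`exists_eq_X_sub_C_pow`). If `c ≠ 0`, the slope is
`0` and the weighted initial form is `(Z - c) ^ n`, which the normal form excludes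
(`mem_maximalIdeal_of_isNormalForm`). So `c = 0` and `P = (𝔪, Z)` is maximal; hence
`f ∈ (𝔪, Z) ^ n`, which says that `a_j ∈ 𝔪 ^ j` (`coeff_mem_pow_of_isNormalForm`).
-/

namespace HypersurfaceSlope

open IsLocalRing

/-! ### Commutative algebra of polynomials and localizations -/

/-- The coefficient of `Z ^ i` in an element of `(I, Z) ^ n` lies in `I ^ (n - i)`. The ideal
`(I, Z)` appears as the set of polynomials with constant coefficient in `I`. -/
lemma coeff_mem_pow_of_mem_pow {R : Type*} [CommRing R] {I : Ideal R} {n : ℕ} {p : R[X]}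
    (hp : p ∈ I.comap constantCoeff ^ n) (i : ℕ) : p.coeff i ∈ I ^ (n - i) := by
  induction n generalizing p i with
  | zero => simp
  | succ n ih =>
    rw [pow_succ] at hp
    induction hp using Submodule.mul_induction_on' with
    | mem_mul_mem a ha b hb =>
      rw [coeff_mul]
      refine Ideal.sum_mem _ fun x hx => ?_
      have hx' := Finset.HasAntidiagonal.mem_antidiagonal.mp hx
      rcases Nat.eq_zero_or_pos x.2 with h2 | h2
      · have hb0 : b.coeff x.2 ∈ I := by rw [h2]; exact hb
        refine Ideal.pow_le_pow_right (?_ : n + 1 - i ≤ n - x.1 + 1) ?_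
        · omega
        · rw [pow_succ]
          exact Ideal.mul_mem_mul (ih ha _) hb0
      · exact Ideal.mul_mem_right _ _ (Ideal.pow_le_pow_right (by omega) (ih ha x.1))
    | add a _ b _ ha hb =>
      rw [coeff_add]
      exact Ideal.add_mem _ ha hb

/-- A ring homomorphism to a local ring factors through a local homomorphism from the localization
at the preimage of the maximal ideal. -/
lemma exists_isLocalHom_localization {A B : Type*} [CommRing A] [CommRing B] [IsLocalRing B]
    (φ : A →+* B) (P : Ideal A) [P.IsPrime] (hP : P = (maximalIdeal B).comap φ) :
    ∃ ψ : Localization.AtPrime P →+* B, IsLocalHom ψ ∧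
      ∀ a, ψ (algebraMap A (Localization.AtPrime P) a) = φ a := by
  have hunit (a : A) : a ∉ P ↔ IsUnit (φ a) := by
    have : a ∈ P ↔ φ a ∈ maximalIdeal B := by rw [← Ideal.mem_comap, ← hP]
    rw [this, mem_maximalIdeal, mem_nonunits_iff, not_not]
  refine ⟨IsLocalization.lift (M := P.primeCompl) (g := φ) fun s => (hunit s).mp s.2, ⟨?_⟩,
    fun a => IsLocalization.lift_eq _ a⟩
  intro y hy
  obtain ⟨a, s, rfl⟩ := IsLocalization.exists_mk'_eq P.primeCompl y
  rw [IsLocalization.lift_mk', Units.isUnit_mul_units] at hy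
  exact (IsLocalization.AtPrime.isUnit_mk'_iff _ P a s).mpr ((hunit a).mpr hy)

/-- Over a field, a monic polynomial of degree `n ≠ 0` that lies in `P ^ n` locally at a prime
ideal `P` is the `n`-th power of a monic linear polynomial, and this generates `P`. -/
lemma exists_eq_X_sub_C_pow {K : Type*} [Field K] {n : ℕ} (hn0 : n ≠ 0) {f : K[X]}
    (hf : f.Monic) (hn : f.natDegree = n) {P : Ideal K[X]} (hP : P.IsPrime) {s : K[X]}
    (hs : s ∉ P) (hsf : s * f ∈ P ^ n) : ∃ c : K, f = (X - C c) ^ n ∧ X - C c ∈ P := by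
  obtain ⟨π, rfl⟩ := (IsPrincipalIdealRing.principal P).principal
  change s ∉ Ideal.span {π} at hs
  change s * f ∈ Ideal.span {π} ^ n at hsf
  change (Ideal.span {π}).IsPrime at hP
  change ∃ c : K, f = (X - C c) ^ n ∧ X - C c ∈ Ideal.span {π}
  rw [Ideal.span_singleton_pow, Ideal.mem_span_singleton] at hsf
  rw [Ideal.mem_span_singleton] at hs
  have hπ0 : π ≠ 0 := by
    rintro rfl
    rw [zero_pow hn0, zero_dvd_iff, mul_eq_zero] at hsf
    rcases hsf with h | h
    · exact hs (by simp [h])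
    · exact hf.ne_zero h
  have hπ : Prime π := (Ideal.span_singleton_prime hπ0).mp hP
  have hdvd : π ^ n ∣ f := hπ.pow_dvd_of_dvd_mul_left n hs hsf
  have hdeg : π.natDegree = 1 := by
    have h1 : n * π.natDegree ≤ n := by
      rw [← natDegree_pow]
      exact (natDegree_le_of_dvd hdvd hf.ne_zero).trans hn.le
    have h2 : 0 < π.natDegree := hπ.irreducible.natDegree_pos
    have h3 : π.natDegree ≤ 1 := by
      by_contra h
      have : n * 2 ≤ n * π.natDegree := Nat.mul_le_mul_left _ (by omega)
      omega
    omega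
  obtain ⟨c, hc⟩ := exists_root_of_degree_eq_one
    (show π.degree = 1 by rw [degree_eq_natDegree hπ0, hdeg]; rfl)
  have hassoc : Associated (X - C c) π :=
    (irreducible_X_sub_C c).associated_of_dvd hπ.irreducible (dvd_iff_isRoot.mpr hc)
  refine ⟨c, ?_, Ideal.mem_span_singleton.mpr hassoc.symm.dvd⟩
  have hmonic : ((X - C c) ^ n).Monic := (monic_X_sub_C c).pow n
  refine eq_of_monic_of_dvd_of_natDegree_le hmonic hf ((hassoc.pow_pow (n := n)).dvd.trans hdvd) ?_
  rw [natDegree_pow, natDegree_X_sub_C, mul_one, hn]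

/-! ### Order, slope and normal form over a local ring -/

section LocalRing

variable {R : Type u} [CommRing R] [IsLocalRing R]

lemma le_order_iff (a : R) (m : ℕ) : (m : ℕ∞) ≤ order a ↔ a ∈ maximalIdeal R ^ m := by
  constructor
  · intro h
    by_contra ha
    have hm : m ≠ 0 := by rintro rfl; simp at ha
    have hle : order a ≤ ((m - 1 : ℕ) : ℕ∞) := by
      refine iSup₂_le fun i hi => ?_
      have : i < m := by
        by_contra hlt
        exact ha (Ideal.pow_le_pow_right (not_lt.mp hlt) hi)
      exact_mod_cast Nat.le_sub_one_of_lt this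
    have : m ≤ m - 1 := by exact_mod_cast h.trans hle
    omega
  · intro h
    exact le_iSup₂ (f := fun (i : ℕ) (_ : a ∈ maximalIdeal R ^ i) => (i : ℕ∞)) m h

lemma one_le_polySlope_iff (n : ℕ) (f : R[X]) :
    1 ≤ polySlope n f ↔ ∀ j ∈ Finset.Icc 1 n, f.coeff (n - j) ∈ maximalIdeal R ^ j := by
  rw [polySlope, Finset.le_inf_iff]
  refine forall₂_congr fun j hj => ?_
  have hj0 : (0 : ℚ) < j := by exact_mod_cast (Finset.mem_Icc.mp hj).1
  rw [← le_order_iff]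
  cases order (f.coeff (n - j)) with
  | top => simp
  | coe m =>
    rw [ENat.map_natCast, ← WithTop.coe_one, WithTop.coe_le_coe, one_le_div hj0]
    norm_cast

/-- A unit constant coefficient forces the slope to vanish. -/
lemma polySlope_eq_zero {n : ℕ} (hn : n ≠ 0) {f : R[X]}
    (h : f.coeff 0 ∉ maximalIdeal R) : polySlope n f = 0 := by
  apply le_antisymm
  · refine (Finset.inf_le (Finset.mem_Icc.mpr ⟨Nat.pos_of_ne_zero hn, le_rfl⟩)).trans ?_
    have h0 : order (f.coeff 0) = 0 := by
      by_contra h0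
      have h1 := (le_order_iff (f.coeff 0) 1).mp (Order.one_le_iff_ne_zero.mpr h0)
      exact h (by rwa [pow_one] at h1)
    rw [Nat.sub_self, h0, ← Nat.cast_zero (R := ℕ∞)]
    change ENat.map _ ((0 : ℕ) : ℕ∞) ≤ 0
    rw [ENat.map_natCast]
    simp
  · refine Finset.le_inf fun j _ => ?_
    cases order (f.coeff (n - j)) with
    | top => simp
    | coe m =>
      rw [ENat.map_natCast, ← WithTop.coe_zero, WithTop.coe_le_coe]
      positivity

/-- For `q = 0` every graded part is the class in degree `0`, whatever `j` is. -/
lemma gradedPart_zero (j : ℕ) (a : R) : gradedPart 0 j a = algebraMap R (Gr R) a := by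
  have h : ∃ m : ℕ, ((m : ℚ) : WithTop ℚ) = j • (0 : WithTop ℚ) ∧ a ∈ maximalIdeal R ^ m :=
    ⟨0, by simp, by simp⟩
  rw [gradedPart, dif_pos h]
  have h0 : h.choose = 0 := by simpa using h.choose_spec.1
  have key : ∀ (m : ℕ) (hm : a ∈ maximalIdeal R ^ m), m = 0 →
      grClass m a hm = algebraMap R (Gr R) a := by
    rintro _ hm rfl
    rfl
  exact key _ _ h0

lemma weightedInitialForm_of_polySlope_eq_zero {n : ℕ} {f : R[X]} (hn : f.natDegree = n)
    (h : polySlope n f = 0) : weightedInitialForm n f = f.map (algebraMap R (Gr R)) := by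
  rw [weightedInitialForm, h, Finset.sum_congr rfl fun j _ => by rw [gradedPart_zero],
    ← Finset.sum_range_reflect, (f.map (algebraMap R (Gr R))).as_sum_range' (n + 1)
      (Nat.lt_succ_of_le (natDegree_map_le.trans hn.le))]
  refine Finset.sum_congr rfl fun i hi => ?_
  have : n - (n + 1 - 1 - i) = i := by have := Finset.mem_range.mp hi; omega
  rw [this, coeff_map]

lemma algebraMap_gr_eq_zero {a : R} (ha : a ∈ maximalIdeal R) : algebraMap R (Gr R) a = 0 :=
  Ideal.Quotient.eq_zero_iff_mem.mpr (Ideal.mem_map_of_mem _ ha)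

/-- If `f` reduces to `(Z - c) ^ n` modulo `𝔪` with `c ≠ 0`, then the slope is `0` and the weighted
initial form is the image of `f` in `gr(R)[Z]`, hence the `n`-th power of `Z - c`. -/
lemma mem_maximalIdeal_of_isNormalForm {n : ℕ} (hn0 : n ≠ 0) {f : R[X]} (hn : f.natDegree = n)
    (hf : IsNormalForm n f) {c : R}
    (hc : f.map (residue R) = ((X - C c) ^ n).map (residue R)) : c ∈ maximalIdeal R := by
  by_contra hcm
  have hcoeff (i : ℕ) : f.coeff i - ((X - C c) ^ n).coeff i ∈ maximalIdeal R := by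
    rw [← residue_eq_zero_iff, map_sub, ← coeff_map, ← coeff_map, hc, sub_self]
  have h0 : f.coeff 0 ∉ maximalIdeal R := by
    intro h
    have h1 := (Submodule.sub_mem_iff_right _ h).mp (hcoeff 0)
    rw [coeff_zero_eq_eval_zero, eval_pow, eval_sub, eval_X, eval_C, zero_sub] at h1
    exact hcm ((neg_mem_iff (H := maximalIdeal R)).mp
      ((maximalIdeal.isMaximal R).isPrime.mem_of_pow_mem _ h1))
  refine hf ⟨(X - C c).map (algebraMap R (Gr R)), ?_⟩
  rw [weightedInitialForm_of_polySlope_eq_zero hn (polySlope_eq_zero hn0 h0),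
    ← Polynomial.map_pow]
  ext i
  rw [coeff_map, coeff_map, ← sub_eq_zero, ← map_sub]
  exact algebraMap_gr_eq_zero (hcoeff i)

/-- The algebraic core: in normal form, if `f` has order at least `n` in the local ring of `R[Z]` at
a prime `P` lying over `𝔪`, then `P = (𝔪, Z)` and the coefficients of `f` satisfy
`a_j ∈ 𝔪 ^ j`. -/
lemma coeff_mem_pow_of_isNormalForm {n : ℕ} {f : R[X]} (hf : f.Monic)
    (hn : f.natDegree = n) (hnf : IsNormalForm n f) (P : Ideal R[X]) [hP : P.IsPrime]
    (hPm : P.comap C = maximalIdeal R)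
    (h : algebraMap R[X] (Localization.AtPrime P) f ∈
      maximalIdeal (Localization.AtPrime P) ^ n) (i : ℕ) :
    f.coeff i ∈ maximalIdeal R ^ (n - i) := by
  rcases eq_or_ne n 0 with rfl | hn0
  · simp
  obtain ⟨s, hs, hsf⟩ : ∃ s ∉ P, s * f ∈ P ^ n := by
    rw [← IsLocalization.AtPrime.map_eq_maximalIdeal P, ← Ideal.map_pow,
      IsLocalization.algebraMap_mem_map_algebraMap_iff P.primeCompl] at h
    exact h
  -- Reduce modulo `𝔪`, to a prime ideal of `κ[Z]`.
  have hsurj : Function.Surjective (mapRingHom (residue R)) :=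
    map_surjective _ residue_surjective
  have hker : RingHom.ker (mapRingHom (residue R)) ≤ P := by
    rw [ker_mapRingHom, ker_residue, Ideal.map_le_iff_le_comap, hPm]
  have hP' := Ideal.map_isPrime_of_surjective hsurj hker
  have hcomap : (P.map (mapRingHom (residue R))).comap (mapRingHom (residue R)) = P := by
    rw [Ideal.comap_map_of_surjective' _ hsurj, sup_eq_left.mpr hker]
  obtain ⟨c', hc', hcP'⟩ := exists_eq_X_sub_C_pow hn0 (hf.map (residue R))
    ((hf.natDegree_map _).trans hn) hP' (s := mapRingHom (residue R) s)
    (fun hmem => hs (by rw [← hcomap]; exact hmem))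
    (by
      rw [← Ideal.map_pow, ← coe_mapRingHom, ← map_mul]
      exact Ideal.mem_map_of_mem _ hsf)
  obtain ⟨c, rfl⟩ := residue_surjective c'
  have hc : c ∈ maximalIdeal R :=
    mem_maximalIdeal_of_isNormalForm hn0 hn hnf (by simpa using hc')
  have hX : X ∈ P := by
    rw [← hcomap, Ideal.mem_comap]
    simpa [(residue_eq_zero_iff c).mpr hc] using hcP'
  -- So `P = (𝔪, Z)` is maximal, and `s` can be cancelled from `s * f ∈ P ^ n`.
  have hPeq : P = (maximalIdeal R).comap constantCoeff := by
    ext p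
    rw [Ideal.mem_comap, constantCoeff_apply, ← hPm, Ideal.mem_comap]
    conv_lhs => rw [← X_mul_divX_add p]
    exact Submodule.add_mem_iff_right _ (Ideal.mul_mem_right _ _ hX)
  have hmax : P.IsMaximal := by
    rw [hPeq]
    exact Ideal.comap_isMaximal_of_surjective _ constantCoeff_surjective
  have hfP : f ∈ P ^ n := (Ideal.IsMaximal.mul_mem_pow P hsf).resolve_left hs
  rw [hPeq] at hfP
  exact coeff_mem_pow_of_mem_pow hfP i

end LocalRing

/-! ### Singular points and étale coordinates -/

section Schemes

variable {V S : Scheme.{u}}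

lemma mem_zeroLocus_singleton_iff (h : Γ(V, ⊤)) (x : V) :
    x ∈ V.zeroLocus {h} ↔
      (V.presheaf.germ ⊤ x trivial).hom h ∈ maximalIdeal (V.presheaf.stalk x) := by
  rw [mem_maximalIdeal, mem_nonunits_iff]
  simp [Scheme.zeroLocus]
  rfl

lemma mem_singLocus_iff (h : Γ(V, ⊤)) (n : ℕ) (x : V) :
    x ∈ singLocus h n ↔
      (V.presheaf.germ ⊤ x trivial).hom h ∈ maximalIdeal (V.presheaf.stalk x) ^ n := by
  constructor
  · intro hx
    exact (le_order_iff _ _).mp (hx n _ (Algebra.subset_adjoin rfl))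
  · intro hx m a ha
    have hle : reesStalk h n x ≤ reesAlgebra (maximalIdeal (V.presheaf.stalk x)) :=
      Algebra.adjoin_le (by simpa [reesAlgebra.monomial_mem] using hx)
    exact (le_order_iff _ _).mpr (reesAlgebra.monomial_mem.mp (hle ha))

lemma germ_appTop (g : V ⟶ S) (x : V) (F : Γ(S, ⊤)) :
    (V.presheaf.germ ⊤ x trivial).hom (g.appTop.hom F) =
      (g.stalkMap x).hom ((S.presheaf.germ ⊤ (g x) trivial).hom F) :=
  (g.germ_stalkMap_apply ⊤ x trivial F).symm

lemma germPoly_monic {f : Γ(S, ⊤)[X]} (hf : f.Monic) (y : S) : (germPoly f y).Monic :=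
  hf.map _

lemma natDegree_germPoly {f : Γ(S, ⊤)[X]} (hf : f.Monic) (y : S) :
    (germPoly f y).natDegree = f.natDegree :=
  hf.natDegree_map _

lemma germ_evalAt (β : V ⟶ S) (z : Γ(V, ⊤)) (f : Γ(S, ⊤)[X]) (x : V) :
    (V.presheaf.germ ⊤ x trivial).hom (evalAt β z f) =
      (germPoly f (β x)).eval₂ (β.stalkMap x).hom ((V.presheaf.germ ⊤ x trivial).hom z) := by
  rw [evalAt, germPoly, hom_eval₂, eval₂_map]
  congr 1
  rw [← CommRingCat.hom_comp, ← CommRingCat.hom_comp]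
  exact congrArg _ (β.germ_stalkMap ⊤ x trivial).symm

lemma appTop_evalAt {W : Scheme.{u}} (g : W ⟶ V) (β : V ⟶ S) (z : Γ(V, ⊤)) (f : Γ(S, ⊤)[X]) :
    g.appTop.hom (evalAt β z f) = evalAt (g ≫ β) (g.appTop.hom z) f := by
  rw [evalAt, evalAt, hom_eval₂, ← CommRingCat.hom_comp, Scheme.Hom.comp_appTop]

/-- Pulling a function back along a morphism does not lower its order. -/
lemma germ_appTop_mem_maximalIdeal_pow (g : V ⟶ S) (x : V) {F : Γ(S, ⊤)} {n : ℕ}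
    (hF : (S.presheaf.germ ⊤ (g x) trivial).hom F ∈ maximalIdeal (S.presheaf.stalk (g x)) ^ n) :
    (V.presheaf.germ ⊤ x trivial).hom (g.appTop.hom F) ∈
      maximalIdeal (V.presheaf.stalk x) ^ n := by
  have h1 := Ideal.mem_map_of_mem (g.stalkMap x).hom hF
  rw [Ideal.map_pow] at h1
  have h2 := Ideal.pow_right_mono (map_maximalIdeal_le (g.stalkMap x).hom) n h1
  rwa [germ_appTop]

/-- An étale morphism is flat and unramified on stalks, so it does not raise orders. -/
lemma mem_maximalIdeal_pow_of_stalkMap_mem (g : V ⟶ S) [Etale g] (x : V) (n : ℕ)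
    {b : S.presheaf.stalk (g x)}
    (h : (g.stalkMap x).hom b ∈ maximalIdeal (V.presheaf.stalk x) ^ n) :
    b ∈ maximalIdeal (S.presheaf.stalk (g x)) ^ n := by
  have hflat := Flat.stalkMap g x
  have hunr := FormallyUnramified.stalkMap g x
  have hft := LocallyOfFiniteType.stalkMap g x
  have hloc : IsLocalHom (g.stalkMap x).hom := inferInstance
  algebraize [(g.stalkMap x).hom]
  have : IsLocalHom (algebraMap (S.presheaf.stalk (g x)) (V.presheaf.stalk x)) := hloc
  have := Module.FaithfullyFlat.of_flat_of_isLocalHom (A := S.presheaf.stalk (g x))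
    (B := V.presheaf.stalk x)
  rw [← Algebra.FormallyUnramified.map_maximalIdeal (R := S.presheaf.stalk (g x)),
    ← Ideal.map_pow] at h
  rw [← Ideal.comap_map_eq_self_of_faithfullyFlat (B := V.presheaf.stalk x)
    (maximalIdeal (S.presheaf.stalk (g x)) ^ n)]
  exact h

/-- Pulling a function back along a morphism from the spectrum of a local ring does not lower its
order at the image of the closed point. -/
lemma appTop_mem_maximalIdeal_pow {L : CommRingCat.{u}} [IsLocalRing L] (T : Spec L ⟶ S) {w : S}
    (hT : T (closedPoint L) = w) {F : Γ(S, ⊤)} {n : ℕ}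
    (hF : (S.presheaf.germ ⊤ w trivial).hom F ∈ maximalIdeal (S.presheaf.stalk w) ^ n) :
    (Scheme.ΓSpecIso L).hom.hom (T.appTop.hom F) ∈ maximalIdeal L ^ n := by
  subst hT
  have h1 := Ideal.mem_map_of_mem (Scheme.stalkClosedPointTo T).hom hF
  rw [Ideal.map_pow] at h1
  have h2 := Ideal.pow_right_mono
    (map_maximalIdeal_le (Scheme.stalkClosedPointTo T).hom) n h1
  have h3 := congrArg (fun φ => φ.hom F) (Scheme.germ_stalkClosedPointTo T ⊤ trivial)
  have h4 : (Scheme.ΓSpecIso L).hom.hom (T.appTop.hom F) =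
      (Scheme.stalkClosedPointTo T).hom
        ((S.presheaf.germ ⊤ (T (closedPoint L)) trivial).hom F) := by
    refine Eq.trans ?_ h3.symm
    simp
    rfl
  rw [h4]
  exact h2

lemma ΓSpecIso_hom_appTop_fromSpecStalk {L : CommRingCat.{u}} (y : S)
    (ι : S.presheaf.stalk y ⟶ L) (a : Γ(S, ⊤)) :
    (Scheme.ΓSpecIso L).hom.hom ((Spec.map ι ≫ S.fromSpecStalk y).appTop.hom a) =
      ι.hom ((S.presheaf.germ ⊤ y trivial).hom a) := by
  have h : (Spec.map ι ≫ S.fromSpecStalk y).appTop ≫ (Scheme.ΓSpecIso L).hom =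
      S.presheaf.germ ⊤ y trivial ≫ ι := by
    rw [Scheme.Hom.comp_appTop, Scheme.fromSpecStalk_appTop]
    simp
  exact congrArg (fun φ => φ.hom a) h

/-- The fibre coordinate identifies the situation at `x`, up to an étale morphism, with the local
ring of `𝒪_{S, β x}[Z]` at a prime ideal lying over the maximal ideal. -/
lemma exists_prime_of_etale (β : V ⟶ S) (z : Γ(V, ⊤))
    [Etale (AffineSpace.homOfVector (n := PUnit.{u + 1}) β (fun _ => z))]
    (f : Γ(S, ⊤)[X]) (n : ℕ) (x : V)
    (h : (V.presheaf.germ ⊤ x trivial).hom (evalAt β z f) ∈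
      maximalIdeal (V.presheaf.stalk x) ^ n) :
    ∃ (P : Ideal (S.presheaf.stalk (β x))[X]) (_ : P.IsPrime),
      P.comap C = maximalIdeal (S.presheaf.stalk (β x)) ∧
      algebraMap (S.presheaf.stalk (β x))[X] (Localization.AtPrime P) (germPoly f (β x)) ∈
        maximalIdeal (Localization.AtPrime P) ^ n := by
  let φ : (S.presheaf.stalk (β x))[X] →+* V.presheaf.stalk x :=
    eval₂RingHom (β.stalkMap x).hom ((V.presheaf.germ ⊤ x trivial).hom z)
  let P : Ideal (S.presheaf.stalk (β x))[X] := (maximalIdeal (V.presheaf.stalk x)).comap φ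
  have hP : P.IsPrime := Ideal.comap_isPrime φ _
  have hφC : φ.comp C = (β.stalkMap x).hom := by ext; simp [φ]
  refine ⟨P, hP, ?_, ?_⟩
  · rw [show P.comap C = (maximalIdeal (V.presheaf.stalk x)).comap (φ.comp C) from
      Ideal.comap_comap _ _, hφC]
    have hβ : IsLocalHom (β.stalkMap x).hom := inferInstance
    exact ((local_hom_TFAE (β.stalkMap x).hom).out 0 4).mp hβ
  obtain ⟨ψ', hψloc, hψ⟩ := exists_isLocalHom_localization φ P rfl
  let L := CommRingCat.of (Localization.AtPrime P)
  let ψ : L ⟶ V.presheaf.stalk x := CommRingCat.ofHom ψ'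
  let θ := algebraMap (S.presheaf.stalk (β x))[X] (Localization.AtPrime P)
  let ι : S.presheaf.stalk (β x) ⟶ L := CommRingCat.ofHom (θ.comp C)
  have hιψ : ι ≫ ψ = β.stalkMap x := by
    ext a
    exact (hψ (C a)).trans (congrArg (fun g => g a) hφC)
  have : IsLocalHom ψ.hom := hψloc
  let T : Spec L ⟶ AffineSpace PUnit.{u + 1} S := AffineSpace.homOfVector
    (Spec.map ι ≫ S.fromSpecStalk (β x)) (fun _ => (Scheme.ΓSpecIso L).inv.hom (θ X))
  -- The local ring `R[Z]_P` maps to the affine line by `T`. Since `ψ` is local, this factorization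
  -- shows that `T` sends the closed point to the image of `x`.
  have hfac : Spec.map ψ ≫ T =
      V.fromSpecStalk x ≫ AffineSpace.homOfVector β (fun _ => z) := by
    rw [AffineSpace.comp_homOfVector, AffineSpace.comp_homOfVector]
    congr 1
    · rw [← Scheme.SpecMap_stalkMap_fromSpecStalk, ← Spec.map_comp_assoc, hιψ]
    · funext i
      have h1 := congrArg (fun g => g.hom (θ X)) (Scheme.ΓSpecIso_inv_naturality ψ)
      refine Eq.trans h1.symm ?_
      have h2 : ψ.hom (θ X) = (V.presheaf.germ ⊤ x trivial).hom z :=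
        (hψ X).trans (eval₂_X _ _)
      refine (congrArg (Scheme.ΓSpecIso (V.presheaf.stalk x)).inv.hom h2).trans ?_
      have h3 : (V.fromSpecStalk x).appTop = V.presheaf.germ ⊤ x trivial ≫
          (Scheme.ΓSpecIso (V.presheaf.stalk x)).inv :=
        Scheme.fromSpecStalk_appTop.trans (congrArg (V.presheaf.germ ⊤ x trivial ≫ ·)
          ((congrArg (_ ≫ ·) ((Spec (V.presheaf.stalk x)).presheaf.map_id _)).trans
            (Category.comp_id _)))
      exact (congrArg (fun g => g.hom z) h3).symm
  have hpt : T (closedPoint L) = AffineSpace.homOfVector β (fun _ => z) x := by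
    have h1 : T (Spec.map ψ (closedPoint (V.presheaf.stalk x))) =
        AffineSpace.homOfVector β (fun _ => z)
          (V.fromSpecStalk x (closedPoint (V.presheaf.stalk x))) :=
      congrArg (fun g => g (closedPoint (V.presheaf.stalk x))) hfac
    rw [Scheme.fromSpecStalk_closedPoint] at h1
    rw [← h1]
    congr 1
    exact (comap_closedPoint ψ.hom).symm
  have hF : ((AffineSpace PUnit.{u + 1} S).presheaf.germ ⊤
      (AffineSpace.homOfVector (n := PUnit.{u + 1}) β (fun _ => z) x) trivial).hom
      (evalAt ((AffineSpace PUnit.{u + 1} S) ↘ S) (AffineSpace.coord S PUnit.unit) f) ∈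
        maximalIdeal _ ^ n := by
    apply mem_maximalIdeal_pow_of_stalkMap_mem
    rw [← germ_appTop, appTop_evalAt]
    convert h using 3
    · exact AffineSpace.homOfVector_over _ _
    · exact AffineSpace.homOfVector_appTop_coord _ _ _
  -- Pulled back along `T`, the function `f(Z)` on the affine line is the germ of `f` in `R[Z]_P`.
  have hT := appTop_mem_maximalIdeal_pow T hpt hF
  rw [appTop_evalAt] at hT
  convert hT using 1
  have hover : T ≫ (AffineSpace PUnit.{u + 1} S) ↘ S = Spec.map ι ≫ S.fromSpecStalk (β x) :=
    AffineSpace.homOfVector_over _ _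
  have hcoord : T.appTop.hom (AffineSpace.coord S PUnit.unit) =
      (Scheme.ΓSpecIso L).inv.hom (θ X) := AffineSpace.homOfVector_appTop_coord _ _ _
  rw [hover, hcoord, evalAt, hom_eval₂]
  have hX : (Scheme.ΓSpecIso L).hom.hom ((Scheme.ΓSpecIso L).inv.hom (θ X)) = θ X := by
    rw [← CommRingCat.comp_apply, Iso.inv_hom_id, CommRingCat.id_apply]
  have hcoeff : (Scheme.ΓSpecIso L).hom.hom.comp (Spec.map ι ≫ S.fromSpecStalk (β x)).appTop.hom =
      (θ.comp C).comp (S.presheaf.germ ⊤ (β x) trivial).hom := by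
    ext a
    exact ΓSpecIso_hom_appTop_fromSpecStalk (β x) ι a
  rw [hX, hcoeff, ← eval₂_map]
  conv_lhs => rw [← eval₂_C_X (p := germPoly f (β x)), hom_eval₂]
  rfl

/-- At a singular point of the hypersurface the slope is at least `1`: the point lies on the
hypersurface, hence in the étale locus of the coordinate. -/
lemma one_le_polySlope_of_mem (β : V ⟶ S) (z : Γ(V, ⊤))
    (f : Γ(S, ⊤)[X]) (hf : f.Monic) (n : ℕ) (hn : f.natDegree = n)
    (hX : IsCoordinateAlong β z (evalAt β z f)) (x : V)
    (hnf : IsNormalForm n (germPoly f (β x)))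
    (hx : x ∈ singLocus (evalAt β z f) n) : 1 ≤ polySlope n (germPoly f (β x)) := by
  rcases eq_or_ne n 0 with rfl | hn0
  -- For `n = 0` the slope is a minimum over the empty set, hence `∞`.
  · simp [one_le_polySlope_iff]
  obtain ⟨U, hU, hetale⟩ := hX
  rw [mem_singLocus_iff] at hx
  have hxU : x ∈ U := by
    apply hU
    rw [mem_zeroLocus_singleton_iff]
    exact Ideal.pow_le_self hn0 hx
  rw [AffineSpace.comp_homOfVector] at hetale
  obtain ⟨x, rfl⟩ : ∃ x' : U.toScheme, U.ι x' = x := ⟨⟨x, hxU⟩, rfl⟩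
  have : Etale (AffineSpace.homOfVector (n := PUnit.{u + 1}) (U.ι ≫ β)
    (fun _ => U.ι.appTop.hom z)) := hetale
  obtain ⟨P, hP, hPm, hfP⟩ := exists_prime_of_etale (U.ι ≫ β) (U.ι.appTop.hom z) f n x (by
    rw [← appTop_evalAt]
    exact germ_appTop_mem_maximalIdeal_pow U.ι x hx)
  rw [one_le_polySlope_iff]
  intro j hj
  have := coeff_mem_pow_of_isNormalForm (germPoly_monic hf (β (U.ι x)))
    ((natDegree_germPoly hf _).trans hn) hnf P (hP := hP) hPm hfP (n - j)
  rwa [Nat.sub_sub_self (Finset.mem_Icc.mp hj).2] at this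

/-- If the slope is at least `1`, then `y` is the image of a singular point, namely of the point
over `y` with `z = 0`. -/
lemma exists_mem_of_one_le_polySlope (β : V ⟶ S) (z : Γ(V, ⊤)) (hz : IsZeroSection β z)
    (f : Γ(S, ⊤)[X]) (hf : f.Monic) (n : ℕ) (hn : f.natDegree = n) (y : S)
    (hy : 1 ≤ polySlope n (germPoly f y)) : y ∈ β '' singLocus (evalAt β z f) n := by
  have : IsIso ((Scheme.IdealSheafData.ofIdealTop (Ideal.span {z})).subschemeι ≫ β) := hz
  obtain ⟨w, rfl⟩ := ((Scheme.IdealSheafData.ofIdealTop (Ideal.span {z})).subschemeι ≫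
    β).homeomorph.surjective y
  set x := (Scheme.IdealSheafData.ofIdealTop (Ideal.span {z})).subschemeι w
  refine ⟨x, ?_, rfl⟩
  change 1 ≤ polySlope n (germPoly f (β x)) at hy
  have hzx : (V.presheaf.germ ⊤ x trivial).hom z ∈ maximalIdeal (V.presheaf.stalk x) := by
    have hx' : x ∈ (Scheme.IdealSheafData.ofIdealTop (Ideal.span {z})).support := by
      rw [← SetLike.mem_coe, ← Scheme.IdealSheafData.range_subschemeι]
      exact ⟨w, rfl⟩
    rw [← SetLike.mem_coe, Scheme.IdealSheafData.coe_support_ofIdealTop] at hx'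
    rw [← mem_zeroLocus_singleton_iff]
    exact Scheme.zeroLocus_mono _
      (Set.singleton_subset_iff.mpr (Ideal.mem_span_singleton_self z)) hx'
  rw [mem_singLocus_iff, germ_evalAt, eval₂_eq_sum_range,
    (natDegree_germPoly hf _).trans hn]
  refine Ideal.sum_mem _ fun i hi => ?_
  have hi : i ≤ n := Nat.lt_succ_iff.mp (Finset.mem_range.mp hi)
  have hcoeff : (germPoly f (β x)).coeff i ∈ maximalIdeal _ ^ (n - i) := by
    rcases hi.eq_or_lt with rfl | hlt
    · simp
    · have := (one_le_polySlope_iff _ _).mp hy (n - i) (Finset.mem_Icc.mpr (by omega))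
      rwa [Nat.sub_sub_self hi] at this
  have h1 := Ideal.mem_map_of_mem (β.stalkMap x).hom hcoeff
  rw [Ideal.map_pow] at h1
  have h2 := Ideal.mul_mem_mul (Ideal.pow_right_mono (map_maximalIdeal_le (β.stalkMap x).hom) _ h1)
    (Ideal.pow_mem_pow hzx i)
  rwa [← pow_add, Nat.sub_add_cancel hi] at h2

end Schemes

end HypersurfaceSlope

theorem mainTheorem10 {k : Type u} [Field k] [PerfectField k]
    {V S : Scheme.{u}} (p : S ⟶ Spec (CommRingCat.of k)) [Smooth p]
    (β : V ⟶ S) [SmoothOfRelativeDimension 1 β]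
    (z : Γ(V, ⊤)) (hz : HypersurfaceSlope.IsZeroSection β z)
    (n : ℕ) (f : Γ(S, ⊤)[X]) (hf : f.Monic) (hn : f.natDegree = n)
    (hX : HypersurfaceSlope.IsCoordinateAlong β z (HypersurfaceSlope.evalAt β z f))
    (y : S) (hy : HypersurfaceSlope.IsNormalForm n (HypersurfaceSlope.germPoly f y)) :
    y ∈ β '' HypersurfaceSlope.singLocus (HypersurfaceSlope.evalAt β z f) n ↔
      1 ≤ HypersurfaceSlope.polySlope n (HypersurfaceSlope.germPoly f y) := by
  constructor
  · rintro ⟨x, hx, rfl⟩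
    exact HypersurfaceSlope.one_le_polySlope_of_mem β z f hf n hn hX x hy hx
  · exact HypersurfaceSlope.exists_mem_of_one_le_polySlope β z hz f hf n hn y
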